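/- Let $\mathcal H_S,\mathcal H_B$ be finite-dimensional complex Hilbert spaces (system and bath), $\mathcal H_B\neq 0$, let $\mathcal C\subseteq\mathcal H_S$ be a nonzero subspace (the code) with orthogonal projector $P_{\mathcal C}$, and put $P=P_{\mathcal C}\otimes 1_B$. A code state is a density operator $\rho$ on $\mathcal H_S\otimes\mathcal H_B$ with $P\rho P=\rho$. A recovery is a completely positive trace-preserving (CPTP) map $\mathcal R_S$ on $\mathscr B(\mathcal H_S)$ with output in the code ($P_{\mathcal C}\mathcal R_S(\cdot)P_{\mathcal C}=\mathcal R_S(\cdot)$), acting on the composite as $\mathcal R=\mathcal R_S\otimes\mathrm{id}_B$. With $F(\rho,\sigma)=\mathrm{Tr}\sqrt{\rho^{1/2}\sigma\rho^{1/2}}$, a CPTP map $\mathcal E$ on $\mathscr B(\mathcal H_S\otimes\mathcal H_B)$ is called $\epsilon$-correctable on $\mathcal C$ if $$\min_{\mathcal R}\ \max_{\rho\text{ code state}}\Bigl[1-F\bigl(\mathrm{Tr}_B\rho,\ \mathrm{Tr}_B(\mathcal R\circ\mathcal E)(\rho)\bigr)^2\Bigr]\le\epsilon .$$ A completely positive (CP)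 map $\widetilde{\mathcal E}$ is called perfectly correctable on $\mathcal C$ if there is a recovery $\mathcal R$ such that for every density operator $\rho_S$ supported on $\mathcal C$ and every bath state $\tau$, $\mathrm{Tr}_B(\mathcal R\circ\widetilde{\mathcal E})(\rho_S\otimes\tau)$ is a scalar multiple of $\rho_S$ (if $\widetilde{\mathcal E}$ is trace preserving, this says by linearity that $\mathrm{Tr}_B(\mathcal R\circ\widetilde{\mathcal E})(\rho)=\mathrm{Tr}_B\rho$ for all code states $\rho$). **Theorem (Approximate OSQEC).** Let $\mathcal E(\cdot)=\sum_{a=1}^N E_a(\cdot)E_a^\dagger$ be CPTP on the system-bath composite, and let $E_a=\widetilde E_a+B_a$ for all $a$, where the CP map $\widetilde{\mathcal E}(\cdot)=\sum_a\widetilde E_a(\cdot)\widetilde E_a^\dagger$ is perfectly correctable on $\mathcal C$. Then $\mathcal E$ is $\epsilon$-correctable on $\mathcal C$ with $$\epsilon=\tfrac18\bigl(1+\sqrt2\bigr)\,\Vert\Theta^\dagger\Theta\Vert+\Vert\Delta\Vert+K\,\Vert BP\Vert^3,$$ where $\Theta=\sum_a P(B_a^\dagger\widetilde E_a-\widetilde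 E_a^\dagger B_a)P$, $\Delta=\sum_a PB_a^\dagger B_aP$, $\Vert\cdot\Vert$ is the operator norm, $\Vert BP\Vert=\bigl\Vert\sum_a (B_aP)^\dagger (B_aP)\bigr\Vert^{1/2}$ is the size of the operators $B_a$ restricted to their action on $P$ (the norm of the column operator $v\mapsto(B_aPv)_a$), and $K$ is an absolute constant, independent of the dimensions, of $N$, of the code and of all the operators. -/

import Mathlib

open scoped Matrix Kronecker ComplexOrder MatrixOrder

noncomputable section

namespace OSQEC

variable {s b ι κ : Type*} [Fintype s] [DecidableEq s] [Fintype b] [DecidableEq b]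
  [Fintype ι] [Fintype κ]

/-- Operator norm of a matrix, acting on the Hilbert space `ℂⁿ`. -/
def opNorm {n : Type*} [Fintype n] [DecidableEq n] (M : Matrix n n ℂ) : ℝ :=
  ‖Matrix.toEuclideanCLM (𝕜 := ℂ) (n := n) M‖

/-- Matrix of the orthogonal projector `P_C` onto the code `C ⊆ H_S`. -/
def codeProj (C : Submodule ℂ (EuclideanSpace ℂ s)) : Matrix s s ℂ :=
  (Matrix.toEuclideanCLM (𝕜 := ℂ) (n := s)).symm C.starProjection

/-- The projector `P = P_C ⊗ 1_B` onto `C ⊗ H_B`. Operators on `H_S ⊗ H_B` are matrices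
indexed by `s × b`. -/
def jointProj (b : Type*) [DecidableEq b] (C : Submodule ℂ (EuclideanSpace ℂ s)) :
    Matrix (s × b) (s × b) ℂ :=
  codeProj C ⊗ₖ (1 : Matrix b b ℂ)

/-- The partial trace over the bath. -/
def traceBath (M : Matrix (s × b) (s × b) ℂ) : Matrix s s ℂ :=
  Matrix.of fun i j => ∑ k, M (i, k) (j, k)

/-- The completely positive map `X ↦ ∑ₐ Kₐ X Kₐ†` with Kraus operators `K`. -/
def krausMap {n : Type*} [Fintype n] (K : ι → Matrix n n ℂ) (X : Matrix n n ℂ) :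
    Matrix n n ℂ :=
  ∑ a, K a * X * (K a)ᴴ

/-- The map with Kraus operators `K` is trace preserving. -/
def IsTracePreserving {n : Type*} [Fintype n] [DecidableEq n] (K : ι → Matrix n n ℂ) : Prop :=
  ∑ a, (K a)ᴴ * K a = 1

/-- Density operators. -/
def IsState {n : Type*} [Fintype n] (ρ : Matrix n n ℂ) : Prop :=
  ρ.PosSemidef ∧ ρ.trace = 1

/-- System code states: states supported on `C`. -/
def IsSystemCodeState (C : Submodule ℂ (EuclideanSpace ℂ s)) (ρ : Matrix s s ℂ) : Prop :=
  IsState ρ ∧ codeProj C * ρ * codeProj C = ρ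

/-- System-bath code states: states, possibly entangled, supported on `C ⊗ H_B`. -/
def IsCodeState (C : Submodule ℂ (EuclideanSpace ℂ s)) (ρ : Matrix (s × b) (s × b) ℂ) : Prop :=
  IsState ρ ∧ jointProj b C * ρ * jointProj b C = ρ

/-- `R` is a family of Kraus operators of a recovery: a trace-preserving completely positive
map on the system alone whose output lies in the code. -/
def IsRecovery (C : Submodule ℂ (EuclideanSpace ℂ s)) (R : κ → Matrix s s ℂ) : Prop :=
  IsTracePreserving R ∧ ∀ c, codeProj C * R c = R c

/-- The reduced system state `Tr_B {((R ⊗ id_B) ∘ E)(ρ)}` after noise and system-only recovery. -/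
def recovered (R : κ → Matrix s s ℂ) (E : ι → Matrix (s × b) (s × b) ℂ)
    (ρ : Matrix (s × b) (s × b) ℂ) : Matrix s s ℂ :=
  traceBath (krausMap (fun c => R c ⊗ₖ (1 : Matrix b b ℂ)) (krausMap E ρ))

/-- The fidelity `F(ρ, σ) = Tr √(√ρ σ √ρ)`. -/
def fidelity {n : Type*} [Fintype n] [DecidableEq n] (ρ σ : Matrix n n ℂ) : ℝ :=
  (CFC.sqrt (CFC.sqrt ρ * σ * CFC.sqrt ρ)).trace.re

/-- The fidelity loss `η_R(ρ) = 1 - F²(Tr_B ρ, Tr_B (R ∘ E)(ρ))`. -/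
def fidelityLoss (R : κ → Matrix s s ℂ) (E : ι → Matrix (s × b) (s × b) ℂ)
    (ρ : Matrix (s × b) (s × b) ℂ) : ℝ :=
  1 - fidelity (traceBath ρ) (recovered R E ρ) ^ 2

/-- The worst-case fidelity loss `η_R(C)` over all system-bath code states
(the losses are at most `1`). -/
def worstLoss (C : Submodule ℂ (EuclideanSpace ℂ s)) (R : κ → Matrix s s ℂ)
    (E : ι → Matrix (s × b) (s × b) ℂ) : ℝ :=
  sSup {η | ∃ ρ, IsCodeState C ρ ∧ η = fidelityLoss R E ρ}

/-- The optimal worst-case fidelity loss `η_op(C)` over all system-only recoveries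
(with finitely many Kraus operators; the losses are at least `0`). -/
def optLoss (C : Submodule ℂ (EuclideanSpace ℂ s)) (E : ι → Matrix (s × b) (s × b) ℂ) : ℝ :=
  sInf {η | ∃ (m : ℕ) (R : Fin m → Matrix s s ℂ), IsRecovery C R ∧ η = worstLoss C R E}

/-- The noise `E` is `ε`-correctable on `C`. -/
def IsEpsCorrectable (C : Submodule ℂ (EuclideanSpace ℂ s)) (E : ι → Matrix (s × b) (s × b) ℂ)
    (ε : ℝ) : Prop :=
  optLoss C E ≤ ε

/-- Perfect correctability on `C` of a completely positive map, not necessarily trace preserving: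
one system-only recovery gives back every system code state `ρ`, whatever the initial bath state
`τ`, up to the probability `c` with which the map occurs. For a trace-preserving map `c = 1`, and
then by linearity `Tr_B (R ∘ E)(ρ) = Tr_B ρ` for all system-bath code states `ρ`, entangled ones
included. -/
def IsPerfectlyCorrectable (C : Submodule ℂ (EuclideanSpace ℂ s))
    (E : ι → Matrix (s × b) (s × b) ℂ) : Prop :=
  ∃ (m : ℕ) (R : Fin m → Matrix s s ℂ), IsRecovery C R ∧
    ∀ (ρ : Matrix s s ℂ) (τ : Matrix b b ℂ), IsSystemCodeState C ρ → IsState τ →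
      ∃ c : ℝ, recovered R E (ρ ⊗ₖ τ) = (c : ℂ) • ρ

/-- `Θ = ∑ₐ P (Bₐ† Ẽₐ - Ẽₐ† Bₐ) P`. -/
def Theta (C : Submodule ℂ (EuclideanSpace ℂ s)) (Et B : ι → Matrix (s × b) (s × b) ℂ) :
    Matrix (s × b) (s × b) ℂ :=
  ∑ a, jointProj b C * ((B a)ᴴ * Et a - (Et a)ᴴ * B a) * jointProj b C

/-- `Δ = ∑ₐ P Bₐ† Bₐ P`. -/
def Delta (C : Submodule ℂ (EuclideanSpace ℂ s)) (B : ι → Matrix (s × b) (s × b) ℂ) :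
    Matrix (s × b) (s × b) ℂ :=
  ∑ a, jointProj b C * ((B a)ᴴ * B a) * jointProj b C

/-- The size of `BP`: the operator norm `√‖∑ₐ (Bₐ P)† (Bₐ P)‖` of the column operator
`v ↦ (Bₐ P v)ₐ`. -/
def sizeBP (C : Submodule ℂ (EuclideanSpace ℂ s)) (B : ι → Matrix (s × b) (s × b) ℂ) : ℝ :=
  √(opNorm (∑ a, (B a * jointProj b C)ᴴ * (B a * jointProj b C)))

end OSQEC

end

/-! The recovery `R` that is perfect for the truncated noise `Et` also works for `E`. Testing it on
pure code states and bath basis states forces every recovered Kraus operator to act trivially on the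
code: `(R c ⊗ 1) Et a P = P_C ⊗ X c a` (`exists_recovered_kraus_eq`). With `G = ∑ X†X`, the sum `∑ P
Et†Et P` is `P_C ⊗ G`; put `h = 1 - G` and `H = P_C ⊗ h`.

The fidelity is bounded below, in the manner of Uhlmann, by the overlap of two purifications
(`re_trace_le_fidelity`). For the recovered state take `(R c ⊗ 1) E a √ρ`; for the input take `(1 ⊗
W) √ρ` with `W = X p`. The ideal choice `p = G^(-1/2)` is replaced by a quadratic polynomial in `h`,
slightly shrunk so that `∑ W†W ≤ 1`; subnormalization suffices. Trace preservation of `E` gives `∑ P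
Et†E P = P - (H + Δ + Θ)/2`, so the overlap is the trace of `ρ` against `(1 ⊗ p)(P - (H + Δ +
Θ)/2)`.

To second order this leaves `1 - Δ/2 - Θ/2 + (11/100) H² - HΘ/4`. As `Θ` is anti-Hermitian, its
first-order term has zero real expectation, and completing the square in `H` costs `(25/176) Θ†Θ`
(`re_trace_mul_overlap_ge`). Doubling yields the coefficients `25/88 < (1 + √2)/8` for `‖Θ†Θ‖` and
`1` for `‖Δ‖`; all else is cubic in `‖BP‖`. When `‖BP‖` is not small, the cubic term alone exceeds
the trivial loss bound `1`. -/

open scoped Matrix.Norms.L2Operator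

/-! ### Contractive factorization, trace inequalities and fidelity. -/

namespace OSQEC

/-- If `‖g x‖ ≤ ‖f x‖` for all `x`, then `g` factors through `f` by a contraction. -/
theorem exists_contraction_comp_eq {D F G : Type*} [AddCommGroup D] [Module ℂ D]
    [NormedAddCommGroup F] [InnerProductSpace ℂ F] [FiniteDimensional ℂ F]
    [NormedAddCommGroup G] [InnerProductSpace ℂ G] (f : D →ₗ[ℂ] F) (g : D →ₗ[ℂ] G)
    (hfg : ∀ x, ‖g x‖ ≤ ‖f x‖) :
    ∃ u : F →ₗ[ℂ] G, (∀ x, u (f x) = g x) ∧ ∀ y, ‖u y‖ ≤ ‖y‖ := by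
  have hker : LinearMap.ker f ≤ LinearMap.ker g := fun x hx => by
    have h := hfg x
    rw [LinearMap.mem_ker.1 hx, norm_zero] at h
    exact LinearMap.mem_ker.2 (norm_le_zero_iff.1 h)
  let v : LinearMap.range f →ₗ[ℂ] G :=
    ((LinearMap.ker f).liftQ g hker) ∘ₗ f.quotKerEquivRange.symm.toLinearMap
  have hv : ∀ x, v ⟨f x, LinearMap.mem_range_self f x⟩ = g x := fun x => by
    have : f.quotKerEquivRange.symm ⟨f x, LinearMap.mem_range_self f x⟩
        = (LinearMap.ker f).mkQ x := by
      rw [LinearEquiv.symm_apply_eq]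
      exact Subtype.ext (f.quotKerEquivRange_apply_mk x).symm
    simp [v, this]
  have hvn : ∀ y : LinearMap.range f, ‖v y‖ ≤ ‖y‖ := by
    rintro ⟨_, x, rfl⟩
    rw [hv]
    exact hfg x
  -- The map on the range of `f` is extended by zero on the orthogonal complement, which keeps it
  -- contractive.
  refine ⟨v ∘ₗ (LinearMap.range f).orthogonalProjectionOnto.toLinearMap, fun x => ?_, fun y => ?_⟩
  · have := (LinearMap.range f).orthogonalProjectionOnto_mem_subspace_eq_self
      ⟨f x, LinearMap.mem_range_self f x⟩
    rw [← hv x]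
    exact congrArg v this
  · exact (hvn _).trans ((LinearMap.range f).norm_orthogonalProjectionOnto_apply_le y)

section Matrices

variable {m n q : Type*} [Fintype m] [Fintype n] [Fintype q] [DecidableEq m] [DecidableEq n]
  [DecidableEq q]

omit [DecidableEq m] in
theorem norm_sq_toEuclideanLin (A : Matrix m n ℂ) (x : EuclideanSpace ℂ n) :
    (‖Matrix.toEuclideanLin A x‖ : ℂ) ^ 2 = star x.ofLp ⬝ᵥ (Aᴴ * A) *ᵥ x.ofLp := by
  rw [← Matrix.mulVec_mulVec, Matrix.dotProduct_mulVec, ← Matrix.star_mulVec]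
  have := inner_self_eq_norm_sq_to_K (𝕜 := ℂ) (Matrix.toEuclideanLin A x)
  rw [EuclideanSpace.inner_eq_star_dotProduct, dotProduct_comm] at this
  exact this.symm

omit [DecidableEq q] in
/-- Douglas factorization: `B†B ≤ A†A` implies `B = U A` with a contraction `U`. -/
theorem exists_contraction_mul_eq (A : Matrix m n ℂ) (B : Matrix q n ℂ)
    (h : (Aᴴ * A - Bᴴ * B).PosSemidef) : ∃ U : Matrix q m ℂ, ‖U‖ ≤ 1 ∧ U * A = B := by
  obtain ⟨u, hu, hu1⟩ := exists_contraction_comp_eq (Matrix.toEuclideanLin A)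
    (Matrix.toEuclideanLin B) fun x => by
      have hx := h.dotProduct_mulVec_nonneg x.ofLp
      rw [Matrix.sub_mulVec, dotProduct_sub, ← norm_sq_toEuclideanLin,
        ← norm_sq_toEuclideanLin, sub_nonneg] at hx
      exact le_of_sq_le_sq (by exact_mod_cast hx) (norm_nonneg _)
  refine ⟨Matrix.toEuclideanLin.symm u, ?_, ?_⟩
  · rw [Matrix.l2_opNorm_def]
    refine ContinuousLinearMap.opNorm_le_bound _ zero_le_one fun y => ?_
    rw [one_mul]
    simpa using hu1 y
  · apply Matrix.toEuclideanLin.injective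
    ext1 x
    rw [← hu x]
    simp [Matrix.toLpLin_apply]

theorem trace_mul_nonneg {A B : Matrix n n ℂ} (hA : A.PosSemidef) (hB : B.PosSemidef) :
    0 ≤ (A * B).trace.re := by
  have hs : (CFC.sqrt B).PosSemidef := Matrix.nonneg_iff_posSemidef.1 (CFC.sqrt_nonneg B)
  have hB' : CFC.sqrt B * CFC.sqrt B = B :=
    CFC.sqrt_mul_sqrt_self B (Matrix.nonneg_iff_posSemidef.2 hB)
  have h := (hA.mul_mul_conjTranspose_same (CFC.sqrt B)).trace_nonneg
  rw [hs.1.eq, Matrix.mul_assoc, Matrix.trace_mul_comm, Matrix.mul_assoc, hB'] at h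
  exact (Complex.le_def.1 h).1

theorem posSemidef_smul_one_sub {A : Matrix n n ℂ} (hA : A.IsHermitian) {r : ℝ} (hr : ‖A‖ ≤ r) :
    ((r : ℂ) • (1 : Matrix n n ℂ) - A).PosSemidef := by
  have h := IsSelfAdjoint.le_algebraMap_norm_self (a := A) hA
  have h1 : algebraMap ℝ (Matrix n n ℂ) ‖A‖ ≤ (r : ℂ) • (1 : Matrix n n ℂ) := by
    have : (r : ℂ) • (1 : Matrix n n ℂ) - algebraMap ℝ (Matrix n n ℂ) ‖A‖
        = ((r - ‖A‖ : ℝ) : ℂ) • (1 : Matrix n n ℂ) := by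
      rw [Algebra.algebraMap_eq_smul_one, Complex.ofReal_sub, sub_smul]
      rfl
    rw [Matrix.le_iff, this]
    exact Matrix.PosSemidef.one.smul (by exact_mod_cast sub_nonneg.2 hr)
  exact Matrix.le_iff.1 (h.trans h1)

omit [DecidableEq n] in
theorem re_trace_conjTranspose (A : Matrix n n ℂ) : Aᴴ.trace.re = A.trace.re := by
  simp [Matrix.trace_conjTranspose]

/-- Only the Hermitian part of `K` contributes to the real part, and `K + K†` lies below `2‖K‖`. -/
theorem re_trace_mul_le {K S : Matrix n n ℂ} (hS : S.PosSemidef) :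
    (K * S).trace.re ≤ ‖K‖ * S.trace.re := by
  have hK : ‖K + Kᴴ‖ ≤ 2 * ‖K‖ := by
    refine (norm_add_le _ _).trans ?_
    rw [Matrix.l2_opNorm_conjTranspose]
    linarith
  have h := trace_mul_nonneg
    (posSemidef_smul_one_sub (Matrix.isHermitian_add_transpose_self K) hK) hS
  have h1 : (Kᴴ * S).trace.re = (K * S).trace.re := by
    rw [← re_trace_conjTranspose, Matrix.conjTranspose_mul, hS.1.eq,
      Matrix.conjTranspose_conjTranspose, Matrix.trace_mul_comm]
  rw [Matrix.sub_mul, Matrix.add_mul, Matrix.smul_mul, Matrix.one_mul, Matrix.trace_sub,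
    Matrix.trace_add, Matrix.trace_smul, Complex.sub_re, Complex.add_re, h1] at h
  simp only [smul_eq_mul, Complex.re_ofReal_mul] at h
  linarith

theorem abs_re_trace_mul_le {K S : Matrix n n ℂ} (hS : S.PosSemidef) :
    |(K * S).trace.re| ≤ ‖K‖ * S.trace.re := by
  refine abs_le'.2 ⟨re_trace_mul_le hS, ?_⟩
  have := re_trace_mul_le (K := -K) hS
  simpa using this

/-- The trace-norm bound `Re Tr (U T) ≤ Tr |T|` for contractions `U`. -/
theorem re_trace_mul_le_of_sq_eq {S T U : Matrix n n ℂ} (hS : S.PosSemidef) (hST : S * S = Tᴴ * T)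
    (hU : ‖U‖ ≤ 1) : (U * T).trace.re ≤ S.trace.re := by
  obtain ⟨V, hV, rfl⟩ := exists_contraction_mul_eq S T (by
    rw [hS.1.eq, hST, sub_self]; exact Matrix.PosSemidef.zero)
  rw [← Matrix.mul_assoc]
  refine (re_trace_mul_le hS).trans ?_
  have h1 : ‖U * V‖ ≤ 1 := (Matrix.l2_opNorm_mul U V).trans (mul_le_one₀ hU (norm_nonneg _) hV)
  have h2 : 0 ≤ S.trace.re := (Complex.le_def.1 hS.trace_nonneg).1
  nlinarith

theorem sqrt_posSemidef (A : Matrix n n ℂ) : (CFC.sqrt A).PosSemidef :=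
  Matrix.nonneg_iff_posSemidef.1 (CFC.sqrt_nonneg A)

theorem sqrt_mul_sqrt {A : Matrix n n ℂ} (hA : A.PosSemidef) : CFC.sqrt A * CFC.sqrt A = A :=
  CFC.sqrt_mul_sqrt_self A (Matrix.nonneg_iff_posSemidef.2 hA)

theorem fidelity_sq_eq {ρ σ : Matrix n n ℂ} (hσ : σ.PosSemidef) :
    CFC.sqrt (CFC.sqrt ρ * σ * CFC.sqrt ρ) * CFC.sqrt (CFC.sqrt ρ * σ * CFC.sqrt ρ)
      = (CFC.sqrt σ * CFC.sqrt ρ)ᴴ * (CFC.sqrt σ * CFC.sqrt ρ) := by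
  have h : (CFC.sqrt σ * CFC.sqrt ρ)ᴴ * (CFC.sqrt σ * CFC.sqrt ρ)
      = CFC.sqrt ρ * σ * CFC.sqrt ρ := by
    rw [Matrix.conjTranspose_mul, (sqrt_posSemidef σ).1.eq, (sqrt_posSemidef ρ).1.eq]
    conv_rhs => rw [← sqrt_mul_sqrt hσ]
    simp only [Matrix.mul_assoc]
  rw [h]
  apply sqrt_mul_sqrt
  rw [← h]
  exact Matrix.posSemidef_conjTranspose_mul_self _

/-- Lower bound on the fidelity by the overlap of a purification of `σ` and a
subnormalized purification of `ρ`. -/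
theorem re_trace_le_fidelity {ρ σ : Matrix n n ℂ} (hρ : ρ.PosSemidef) (A D : Matrix n q ℂ)
    (hA : (ρ - A * Aᴴ).PosSemidef) (hD : σ = D * Dᴴ) :
    (Aᴴ * D).trace.re ≤ fidelity ρ σ := by
  have hσ : σ.PosSemidef := hD ▸ Matrix.posSemidef_self_mul_conjTranspose D
  obtain ⟨V, hV, hVA⟩ := exists_contraction_mul_eq (CFC.sqrt ρ) Aᴴ (by
    rw [(sqrt_posSemidef ρ).1.eq, sqrt_mul_sqrt hρ, Matrix.conjTranspose_conjTranspose]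
    exact hA)
  obtain ⟨W, hW, hWD⟩ := exists_contraction_mul_eq (CFC.sqrt σ) Dᴴ (by
    rw [(sqrt_posSemidef σ).1.eq, sqrt_mul_sqrt hσ, Matrix.conjTranspose_conjTranspose, hD,
      sub_self]
    exact Matrix.PosSemidef.zero)
  have hn : ‖Vᴴ * W‖ ≤ 1 := (Matrix.l2_opNorm_mul _ _).trans
    (mul_le_one₀ (by rwa [Matrix.l2_opNorm_conjTranspose]) (norm_nonneg _) hW)
  have key := re_trace_mul_le_of_sq_eq (sqrt_posSemidef _) (fidelity_sq_eq (ρ := ρ) hσ) hn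
  refine le_of_eq_of_le ?_ key
  have hA' : A = CFC.sqrt ρ * Vᴴ := by
    rw [← Matrix.conjTranspose_conjTranspose A, ← hVA, Matrix.conjTranspose_mul,
      (sqrt_posSemidef ρ).1.eq]
  rw [← re_trace_conjTranspose, Matrix.conjTranspose_mul, Matrix.conjTranspose_conjTranspose,
    ← hWD, hA']
  congr 1
  rw [← Matrix.mul_assoc, Matrix.trace_mul_comm]
  simp only [Matrix.mul_assoc]

theorem fidelity_nonneg (ρ σ : Matrix n n ℂ) : 0 ≤ fidelity ρ σ :=
  (Complex.le_def.1 (sqrt_posSemidef _).trace_nonneg).1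

theorem re_trace_contraction_le {A U : Matrix n n ℂ} (hU : ‖U‖ ≤ 1) :
    ((U * A)ᴴ * (U * A)).trace.re ≤ (Aᴴ * A).trace.re := by
  have h : ((U * A)ᴴ * (U * A)).trace.re = ((Uᴴ * U) * (A * Aᴴ)).trace.re := by
    rw [Matrix.conjTranspose_mul, Matrix.mul_assoc, Matrix.trace_mul_comm]
    simp only [Matrix.mul_assoc]
  rw [h]
  refine (re_trace_mul_le (Matrix.posSemidef_self_mul_conjTranspose A)).trans ?_
  rw [Matrix.l2_opNorm_conjTranspose_mul_self, Matrix.trace_mul_comm]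
  have h2 : 0 ≤ (Aᴴ * A).trace.re :=
    (Complex.le_def.1 (Matrix.posSemidef_conjTranspose_mul_self A).trace_nonneg).1
  nlinarith [norm_nonneg U, mul_le_one₀ hU (norm_nonneg U) hU]

/-- With `S = U √σ √ρ` for a contraction `U`, expand `0 ≤ Tr |√σ - U†√ρ|²`: the cross terms give `-2
Tr S` and the squares at most `2`. -/
theorem fidelity_le_one {ρ σ : Matrix n n ℂ} (hρ : IsState ρ) (hσ : IsState σ) :
    fidelity ρ σ ≤ 1 := by
  set S := CFC.sqrt (CFC.sqrt ρ * σ * CFC.sqrt ρ) with hSdef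
  have hS : S.PosSemidef := sqrt_posSemidef _
  obtain ⟨U, hU, hUS⟩ := exists_contraction_mul_eq (CFC.sqrt σ * CFC.sqrt ρ) S (by
    rw [← fidelity_sq_eq hσ.1, hS.1.eq, ← hSdef, sub_self]
    exact Matrix.PosSemidef.zero)
  have h := (Complex.le_def.1 (Matrix.posSemidef_conjTranspose_mul_self
    (CFC.sqrt σ - Uᴴ * CFC.sqrt ρ)).trace_nonneg).1
  have hUn : ‖Uᴴ‖ ≤ 1 := by rwa [Matrix.l2_opNorm_conjTranspose]
  have h1 := re_trace_contraction_le (A := CFC.sqrt ρ) hUn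
  have h2 : ((Uᴴ * CFC.sqrt ρ)ᴴ * CFC.sqrt σ).trace.re = S.trace.re := by
    rw [← hUS, Matrix.conjTranspose_mul, Matrix.conjTranspose_conjTranspose,
      (sqrt_posSemidef ρ).1.eq, Matrix.mul_assoc, Matrix.trace_mul_comm, Matrix.mul_assoc]
  have h3 : ((CFC.sqrt σ)ᴴ * (Uᴴ * CFC.sqrt ρ)).trace.re = S.trace.re := by
    rw [← h2, ← re_trace_conjTranspose, Matrix.conjTranspose_mul,
      Matrix.conjTranspose_conjTranspose]
  rw [Matrix.conjTranspose_sub, Matrix.sub_mul, Matrix.mul_sub, Matrix.mul_sub, Matrix.trace_sub,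
    Matrix.trace_sub, Matrix.trace_sub, Complex.sub_re, Complex.sub_re, Complex.sub_re, h2, h3,
    (sqrt_posSemidef σ).1.eq, sqrt_mul_sqrt hσ.1, hσ.2] at h
  rw [(sqrt_posSemidef ρ).1.eq, sqrt_mul_sqrt hρ.1, hρ.2] at h1
  simp only [Complex.one_re, Complex.zero_re] at h h1
  change S.trace.re ≤ 1
  linarith

/-- Cauchy-Schwarz inequality for families of operators. -/
theorem norm_sum_conjTranspose_mul_le {ι : Type*} [Fintype ι] (A B : ι → Matrix m n ℂ) :
    ‖∑ a, (A a)ᴴ * B a‖ ≤ √‖∑ a, (A a)ᴴ * A a‖ * √‖∑ a, (B a)ᴴ * B a‖ := by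
  classical
  -- Stacking the family into one column operator reduces the claim to submultiplicativity of the
  -- norm.
  let col : (ι → Matrix m n ℂ) → Matrix (ι × m) n ℂ := fun A => Matrix.of fun p j => A p.1 p.2 j
  have hcol : ∀ A B, ∑ a, (A a)ᴴ * B a = (col A)ᴴ * col B := fun A B => by
    ext i j
    simp [col, Matrix.mul_apply, Matrix.sum_apply, Fintype.sum_prod_type]
  rw [hcol, hcol, hcol, Matrix.l2_opNorm_conjTranspose_mul_self,
    Matrix.l2_opNorm_conjTranspose_mul_self, Real.sqrt_mul_self (norm_nonneg _),
    Real.sqrt_mul_self (norm_nonneg _), ← Matrix.l2_opNorm_conjTranspose (col A)]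
  exact Matrix.l2_opNorm_mul _ _

end Matrices

end OSQEC
namespace OSQEC

/-! ### The code projector and operators acting as scalars on the code. -/

section Projector

variable {s : Type*} [Fintype s] [DecidableEq s] (C : Submodule ℂ (EuclideanSpace ℂ s))

omit C in
theorem toEuclideanCLM_injective :
    Function.Injective (Matrix.toEuclideanCLM (𝕜 := ℂ) (n := s)) :=
  EquivLike.injective _

theorem toEuclideanCLM_codeProj :
    Matrix.toEuclideanCLM (𝕜 := ℂ) (n := s) (codeProj C) = C.starProjection :=
  (Matrix.toEuclideanCLM (𝕜 := ℂ) (n := s)).apply_symm_apply _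

theorem codeProj_mul_self : codeProj C * codeProj C = codeProj C := by
  apply toEuclideanCLM_injective
  rw [map_mul, toEuclideanCLM_codeProj]
  exact C.isIdempotentElem_starProjection

theorem codeProj_conjTranspose : (codeProj C)ᴴ = codeProj C := by
  apply toEuclideanCLM_injective
  rw [← Matrix.star_eq_conjTranspose, map_star, toEuclideanCLM_codeProj]
  exact isSelfAdjoint_starProjection C

variable {C}

theorem codeProj_mulVec {x : EuclideanSpace ℂ s} (hx : x ∈ C) :
    codeProj C *ᵥ x.ofLp = x.ofLp := by
  rw [← Matrix.ofLp_toEuclideanCLM, toEuclideanCLM_codeProj,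
    Submodule.starProjection_eq_self_iff.2 hx]

/-- An operator for which every code vector is an eigenvector is a scalar on the code. -/
theorem exists_mul_codeProj_eq_smul {A : Matrix s s ℂ}
    (h : ∀ x ∈ C, ∃ z : ℂ, A *ᵥ x.ofLp = z • x.ofLp) :
    ∃ z : ℂ, A * codeProj C = z • codeProj C := by
  have hmem : ∀ x ∈ C, Matrix.toEuclideanLin A x ∈ C := fun x hx => by
    obtain ⟨z, hz⟩ := h x hx
    have : Matrix.toEuclideanLin A x = z • x := WithLp.ofLp_injective 2 hz
    rw [this]
    exact C.smul_mem z hx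
  obtain ⟨z, hz⟩ := LinearMap.exists_eq_smul_id_of_forall_notLinearIndependent
    (f := (Matrix.toEuclideanLin A).restrict hmem) fun v hv => by
      obtain ⟨z, hz⟩ := h v v.2
      have := LinearIndependent.pair_iff.1 hv z (-1) (by
        apply Subtype.ext
        ext1
        simp [hz])
      simp at this
  refine ⟨z, toEuclideanCLM_injective ?_⟩
  ext1 x
  rw [map_mul, map_smul, toEuclideanCLM_codeProj]
  have := LinearMap.congr_fun hz ⟨C.starProjection x, C.starProjection_apply_mem x⟩
  exact congrArg Subtype.val this

/-- If a sum of rank one operators `A ψψ† A†` is proportional to `ψψ†`, then each `A` maps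
`ψ` to a multiple of `ψ`. -/
theorem exists_mulVec_eq_smul_of_sum {j : Type*} [Fintype j] (A : j → Matrix s s ℂ)
    (x : EuclideanSpace ℂ s) (z : ℂ)
    (h : ∑ i, A i * Matrix.vecMulVec x.ofLp (star x.ofLp) * (A i)ᴴ
      = z • Matrix.vecMulVec x.ofLp (star x.ofLp)) (i : j) :
    ∃ w : ℂ, A i *ᵥ x.ofLp = w • x.ofLp := by
  have hmem : Matrix.toEuclideanLin (A i) x ∈ (ℂ ∙ x) := by
    rw [← (ℂ ∙ x).orthogonal_orthogonal]
    refine (Submodule.mem_orthogonal _ _).2 fun y hy => ?_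
    have hy0 : star x.ofLp ⬝ᵥ y.ofLp = 0 := by
      have := Submodule.mem_orthogonal_singleton_iff_inner_right.1 hy
      rwa [EuclideanSpace.inner_eq_star_dotProduct, dotProduct_comm] at this
    -- Tested against `y ⊥ x`, the right side of `h` vanishes while the left side is a sum of
    -- squared moduli.
    have hsum : ∑ i, star (star y.ofLp ⬝ᵥ A i *ᵥ x.ofLp) * (star y.ofLp ⬝ᵥ A i *ᵥ x.ofLp) = 0 := by
      have h1 := congrArg (fun M => star y.ofLp ⬝ᵥ M *ᵥ y.ofLp) h
      simp only [Matrix.smul_mulVec, Matrix.vecMulVec_mulVec, hy0, Matrix.sum_mulVec,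
        dotProduct_sum, MulOpposite.op_zero, zero_smul, smul_zero, dotProduct_zero] at h1
      rw [← h1]
      refine Finset.sum_congr rfl fun i _ => ?_
      rw [Matrix.mul_vecMulVec, Matrix.vecMulVec_mul, Matrix.vecMulVec_mulVec,
        ← Matrix.star_mulVec, dotProduct_smul, Matrix.star_dotProduct]
      simp [mul_comm]
    have h0 := (Finset.sum_eq_zero_iff_of_nonneg fun i _ => star_mul_self_nonneg _).1 hsum i
      (Finset.mem_univ i)
    rw [EuclideanSpace.inner_eq_star_dotProduct, dotProduct_comm]
    simpa using h0
  obtain ⟨w, hw⟩ := Submodule.mem_span_singleton.1 hmem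
  exact ⟨w, (congrArg WithLp.ofLp hw).symm⟩

end Projector

/-! ### Partial trace and purifications. -/

section PartialTrace

variable {s b q j : Type*} [Fintype s] [DecidableEq s] [Fintype b] [DecidableEq b]
  [Fintype q] [Fintype j]

omit [Fintype s] [DecidableEq s] [DecidableEq b] in
theorem traceBath_sum (M : j → Matrix (s × b) (s × b) ℂ) :
    traceBath (∑ i, M i) = ∑ i, traceBath (M i) := by
  ext x y
  simp only [traceBath, Matrix.of_apply, Matrix.sum_apply]
  exact Finset.sum_comm

omit [Fintype s] [DecidableEq s] [DecidableEq b] in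
theorem traceBath_sub (M N : Matrix (s × b) (s × b) ℂ) :
    traceBath (M - N) = traceBath M - traceBath N := by
  ext x y
  simp [traceBath]

omit [DecidableEq s] [DecidableEq b] in
theorem trace_traceBath (M : Matrix (s × b) (s × b) ℂ) : (traceBath M).trace = M.trace := by
  simp [traceBath, Matrix.trace, Fintype.sum_prod_type]

omit [DecidableEq b] in
theorem traceBath_conj_one_kronecker (K : Matrix b b ℂ) (M : Matrix (s × b) (s × b) ℂ) :
    traceBath (((1 : Matrix s s ℂ) ⊗ₖ K) * M * ((1 : Matrix s s ℂ) ⊗ₖ K)ᴴ)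
      = traceBath (((1 : Matrix s s ℂ) ⊗ₖ (Kᴴ * K)) * M) := by
  ext x y
  simp only [traceBath, Matrix.of_apply, Matrix.mul_apply, Fintype.sum_prod_type,
    Matrix.kronecker_apply, Matrix.conjTranspose_apply, Matrix.one_apply, ite_mul, one_mul,
    zero_mul, apply_ite (star : ℂ → ℂ), star_zero, mul_ite, mul_zero, Finset.sum_ite_eq,
    Finset.sum_ite_irrel, Finset.sum_const_zero, Finset.mem_univ, if_true, Finset.sum_mul]
  rw [Finset.sum_comm]
  refine Finset.sum_congr rfl fun k _ => ?_
  rw [Finset.sum_comm]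
  refine Finset.sum_congr rfl fun l _ => Finset.sum_congr rfl fun i _ => ?_
  ring

/-- The matrix `H_B ⊗ ℂ^q ⊗ ℂ^j → H_S` obtained from a family of operators by moving the bath
output to the input side: a purification of the reduced state `Tr_B ∑ Zᵢ Zᵢ†`. -/
def purify (Z : j → Matrix (s × b) q ℂ) : Matrix s ((b × q) × j) ℂ :=
  Matrix.of fun x p => Z p.2 (x, p.1.1) p.1.2

omit [Fintype s] [DecidableEq s] [DecidableEq b] in
theorem purify_mul_conjTranspose (Z : j → Matrix (s × b) q ℂ) :
    purify Z * (purify Z)ᴴ = ∑ i, traceBath (Z i * (Z i)ᴴ) := by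
  ext x y
  simp only [purify, traceBath, Matrix.mul_apply, Matrix.sum_apply, Matrix.conjTranspose_apply,
    Matrix.of_apply, Fintype.sum_prod_type]
  rw [Finset.sum_comm (s := (Finset.univ : Finset j))]
  refine Finset.sum_congr rfl fun k _ => ?_
  rw [Finset.sum_comm]

omit [DecidableEq s] [DecidableEq b] in
theorem trace_purify_conjTranspose_mul (Z Z' : j → Matrix (s × b) q ℂ) :
    ((purify Z)ᴴ * purify Z').trace = ∑ i, ((Z i)ᴴ * Z' i).trace := by
  simp only [purify, Matrix.trace, Matrix.diag, Matrix.mul_apply, Matrix.conjTranspose_apply,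
    Matrix.of_apply, Fintype.sum_prod_type]
  rw [Finset.sum_comm, Finset.sum_comm (s := (Finset.univ : Finset j))]
  refine Finset.sum_congr rfl fun l _ => ?_
  rw [Finset.sum_comm]
  refine Finset.sum_congr rfl fun i _ => ?_
  rw [Finset.sum_comm]

theorem traceBath_posSemidef {M : Matrix (s × b) (s × b) ℂ} (hM : M.PosSemidef) :
    (traceBath M).PosSemidef := by
  have h := purify_mul_conjTranspose fun _ : Unit => CFC.sqrt M
  rw [Finset.univ_unique, Finset.sum_singleton, (sqrt_posSemidef M).1.eq, sqrt_mul_sqrt hM] at h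
  rw [← h]
  exact Matrix.posSemidef_self_mul_conjTranspose _

theorem traceBath_isState {ρ : Matrix (s × b) (s × b) ℂ} (h : IsState ρ) :
    IsState (traceBath ρ) :=
  ⟨traceBath_posSemidef h.1, (trace_traceBath ρ).trans h.2⟩

/-- A subnormalized family of bath operators does not increase the reduced state. -/
theorem traceBath_sub_purify_posSemidef {W : j → Matrix b b ℂ}
    (hW : (1 - ∑ i, (W i)ᴴ * W i).PosSemidef) (L : Matrix (s × b) q ℂ) :
    (traceBath (L * Lᴴ) - purify (fun i => ((1 : Matrix s s ℂ) ⊗ₖ W i) * L)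
      * (purify fun i => ((1 : Matrix s s ℂ) ⊗ₖ W i) * L)ᴴ).PosSemidef := by
  -- `Q` is the bath operator that completes the `W i` to a trace-preserving family; the difference
  -- is exactly the reduced state of its branch, hence positive.
  set Q := CFC.sqrt (1 - ∑ i, (W i)ᴴ * W i) with hQdef
  have hQ : Qᴴ * Q = 1 - ∑ i, (W i)ᴴ * W i := by
    rw [(sqrt_posSemidef _).1.eq, hQdef, sqrt_mul_sqrt hW]
  have h : traceBath (L * Lᴴ) - purify (fun i => ((1 : Matrix s s ℂ) ⊗ₖ W i) * L)
      * (purify fun i => ((1 : Matrix s s ℂ) ⊗ₖ W i) * L)ᴴ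
      = traceBath (((1 : Matrix s s ℂ) ⊗ₖ Q) * (L * Lᴴ) * ((1 : Matrix s s ℂ) ⊗ₖ Q)ᴴ) := by
    rw [traceBath_conj_one_kronecker, hQ, purify_mul_conjTranspose]
    have h1 : ∀ i, traceBath (((1 : Matrix s s ℂ) ⊗ₖ W i) * L * (((1 : Matrix s s ℂ) ⊗ₖ W i) * L)ᴴ)
        = traceBath (((1 : Matrix s s ℂ) ⊗ₖ ((W i)ᴴ * W i)) * (L * Lᴴ)) := fun i => by
      rw [← traceBath_conj_one_kronecker, Matrix.conjTranspose_mul]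
      simp only [Matrix.mul_assoc]
    simp only [h1]
    rw [← traceBath_sum, ← traceBath_sub, ← Finset.sum_mul]
    congr 1
    have h2 : (1 : Matrix s s ℂ) ⊗ₖ (1 - ∑ i, (W i)ᴴ * W i)
        = 1 - ∑ i, (1 : Matrix s s ℂ) ⊗ₖ ((W i)ᴴ * W i) := by
      ext ⟨a, k⟩ ⟨c, l⟩
      simp [Matrix.one_apply, Matrix.sum_apply, mul_sub, Finset.mul_sum, ite_and]
      split_ifs <;> rfl
    rw [h2, Matrix.sub_mul, Matrix.one_mul]
  rw [h]
  exact traceBath_posSemidef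
    ((Matrix.posSemidef_self_mul_conjTranspose L).mul_mul_conjTranspose_same _)

end PartialTrace

/-! ### Structure of perfectly recovered noise. -/

section Recovery

variable {s b ι κ : Type*} [Fintype s] [DecidableEq s] [Fintype b] [DecidableEq b]
  [Fintype ι] [Fintype κ]

omit [DecidableEq s] in
theorem recovered_eq_sum (R : κ → Matrix s s ℂ) (E : ι → Matrix (s × b) (s × b) ℂ)
    (ρ : Matrix (s × b) (s × b) ℂ) :
    recovered R E ρ = ∑ p : κ × ι, traceBath (((R p.1 ⊗ₖ (1 : Matrix b b ℂ)) * E p.2) * ρ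
      * ((R p.1 ⊗ₖ (1 : Matrix b b ℂ)) * E p.2)ᴴ) := by
  rw [recovered, krausMap, krausMap, traceBath_sum, Fintype.sum_prod_type]
  refine Finset.sum_congr rfl fun c _ => ?_
  rw [Finset.mul_sum, Finset.sum_mul, traceBath_sum]
  refine Finset.sum_congr rfl fun a _ => ?_
  rw [Matrix.conjTranspose_mul]
  simp only [Matrix.mul_assoc]

omit [DecidableEq s] in
theorem recovered_eq_purify (R : κ → Matrix s s ℂ) (E : ι → Matrix (s × b) (s × b) ℂ)
    {q : Type*} [Fintype q] (L : Matrix (s × b) q ℂ) :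
    recovered R E (L * Lᴴ)
      = (purify fun p : κ × ι => ((R p.1 ⊗ₖ (1 : Matrix b b ℂ)) * E p.2) * L)
        * (purify fun p : κ × ι => ((R p.1 ⊗ₖ (1 : Matrix b b ℂ)) * E p.2) * L)ᴴ := by
  rw [recovered_eq_sum, purify_mul_conjTranspose]
  refine Finset.sum_congr rfl fun p _ => ?_
  rw [Matrix.conjTranspose_mul _ L]
  simp only [Matrix.mul_assoc]

theorem krausMap_trace {n : Type*} [Fintype n] [DecidableEq n] {K : ι → Matrix n n ℂ}
    (hK : IsTracePreserving K) (X : Matrix n n ℂ) : (krausMap K X).trace = X.trace := by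
  have : (krausMap K X).trace = ((∑ a, (K a)ᴴ * K a) * X).trace := by
    rw [krausMap, Matrix.trace_sum, Finset.sum_mul, Matrix.trace_sum]
    refine Finset.sum_congr rfl fun a _ => ?_
    rw [Matrix.trace_mul_comm, Matrix.mul_assoc]
  rw [this, hK, Matrix.one_mul]

theorem isTracePreserving_kronecker {R : κ → Matrix s s ℂ} (hR : IsTracePreserving R) :
    IsTracePreserving fun c => R c ⊗ₖ (1 : Matrix b b ℂ) := by
  have : ∀ c, (R c ⊗ₖ (1 : Matrix b b ℂ))ᴴ * (R c ⊗ₖ (1 : Matrix b b ℂ))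
      = ((R c)ᴴ * R c) ⊗ₖ (1 : Matrix b b ℂ) := fun c => by
    rw [Matrix.conjTranspose_kronecker, ← Matrix.mul_kronecker_mul, Matrix.conjTranspose_one,
      Matrix.one_mul]
  unfold IsTracePreserving
  simp only [this]
  rw [← Matrix.one_kronecker_one, ← hR]
  ext ⟨a, k⟩ ⟨c, l⟩
  simp [Matrix.sum_apply, Finset.sum_mul]

theorem recovered_isState {R : κ → Matrix s s ℂ} {E : ι → Matrix (s × b) (s × b) ℂ}
    (hR : IsTracePreserving R) (hE : IsTracePreserving E) {ρ : Matrix (s × b) (s × b) ℂ}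
    (hρ : IsState ρ) : IsState (recovered R E ρ) := by
  refine ⟨?_, ?_⟩
  · have h : ρ = CFC.sqrt ρ * (CFC.sqrt ρ)ᴴ := by
      rw [(sqrt_posSemidef ρ).1.eq, sqrt_mul_sqrt hρ.1]
    rw [h, recovered_eq_purify]
    exact Matrix.posSemidef_self_mul_conjTranspose _
  · rw [recovered, trace_traceBath, krausMap_trace (isTracePreserving_kronecker hR),
      krausMap_trace hE, hρ.2]

omit [DecidableEq s] in
-- With the bath starting in a basis state, the blocks `⟨l|M|k⟩` serve as Kraus operators on the
-- system alone.
theorem traceBath_conj_kronecker_single (M : Matrix (s × b) (s × b) ℂ) (ρ : Matrix s s ℂ) (k : b) :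
    traceBath (M * (ρ ⊗ₖ Matrix.single k k 1) * Mᴴ)
      = ∑ l, (Matrix.of fun x y => M (x, l) (y, k)) * ρ
        * (Matrix.of fun x y => M (x, l) (y, k))ᴴ := by
  ext x y
  simp [traceBath, Matrix.mul_apply, Matrix.sum_apply, Fintype.sum_prod_type,
    Matrix.single_apply, Finset.sum_mul, ite_and]

/-- After a perfect recovery the Kraus operators act trivially on the code. -/
theorem exists_recovered_kraus_eq {C : Submodule ℂ (EuclideanSpace ℂ s)} {R : κ → Matrix s s ℂ}
    {E : ι → Matrix (s × b) (s × b) ℂ}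
    (h : ∀ (ρ : Matrix s s ℂ) (τ : Matrix b b ℂ), IsSystemCodeState C ρ → IsState τ →
      ∃ c : ℝ, recovered R E (ρ ⊗ₖ τ) = (c : ℂ) • ρ) :
    ∃ X : κ → ι → Matrix b b ℂ, ∀ c a,
      (R c ⊗ₖ (1 : Matrix b b ℂ)) * E a * jointProj b C = codeProj C ⊗ₖ X c a := by
  have key : ∀ c a l k, ∃ z : ℂ, (Matrix.of fun x y =>
      ((R c ⊗ₖ (1 : Matrix b b ℂ)) * E a) (x, l) (y, k)) * codeProj C = z • codeProj C := by
    intro c a l k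
    apply exists_mul_codeProj_eq_smul
    intro x hx
    by_cases hx0 : x = 0
    · exact ⟨0, by simp [hx0]⟩
    obtain ⟨y, hyC, hy1, r, hr⟩ : ∃ y ∈ C, ‖y‖ = 1 ∧ ∃ r : ℂ, x = r • y := by
      have hn : (‖x‖ : ℂ) ≠ 0 := by exact_mod_cast norm_ne_zero_iff.2 hx0
      exact ⟨(‖x‖ : ℂ)⁻¹ • x, C.smul_mem _ hx, norm_smul_inv_norm hx0, ‖x‖,
        (smul_inv_smul₀ hn x).symm⟩
    have hst : IsSystemCodeState C (Matrix.vecMulVec y.ofLp (star y.ofLp)) := by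
      refine ⟨⟨Matrix.posSemidef_vecMulVec_self_star _, ?_⟩, ?_⟩
      · rw [Matrix.trace_vecMulVec, ← EuclideanSpace.inner_eq_star_dotProduct,
          inner_self_eq_norm_sq_to_K, hy1]
        simp
      · rw [Matrix.mul_vecMulVec, Matrix.vecMulVec_mul, codeProj_mulVec hyC]
        congr 1
        rw [← codeProj_conjTranspose, ← Matrix.star_mulVec, codeProj_mulVec hyC]
    -- Bath basis states suffice: as `k` and `l` vary, the blocks `⟨l|·|k⟩` determine the whole
    -- operator.
    have hτ : IsState (Matrix.single k k (1 : ℂ)) := by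
      refine ⟨?_, by simp⟩
      have : Matrix.single k k (1 : ℂ) = Matrix.single k k 1 * (Matrix.single k k 1)ᴴ := by simp
      rw [this]
      exact Matrix.posSemidef_self_mul_conjTranspose _
    obtain ⟨z, hz⟩ := h _ _ hst hτ
    rw [recovered_eq_sum] at hz
    simp only [traceBath_conj_kronecker_single] at hz
    rw [← Fintype.sum_prod_type'] at hz
    obtain ⟨w, hw⟩ := exists_mulVec_eq_smul_of_sum _ y z hz ((c, a), l)
    refine ⟨w, ?_⟩
    rw [hr, WithLp.ofLp_smul, Matrix.mulVec_smul, hw, smul_comm]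
  choose z hz using key
  refine ⟨fun c a => Matrix.of fun l k => z c a l k, fun c a => ?_⟩
  ext ⟨x, l⟩ ⟨y, k⟩
  have := congrFun (congrFun (hz c a l k) x) y
  simp only [Matrix.mul_apply (M := Matrix.of _), Matrix.of_apply, Matrix.smul_apply,
    smul_eq_mul] at this
  rw [Matrix.kronecker_apply, mul_comm]
  refine Eq.trans ?_ this
  rw [jointProj, Matrix.mul_apply]
  simp [Fintype.sum_prod_type, Matrix.one_apply]

end Recovery

/-! ### Recovering a bath operator's norm from its action on the code. -/

section Compression

variable {s b : Type*} [Fintype s] [DecidableEq s] [Fintype b] [DecidableEq b]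
  {C : Submodule ℂ (EuclideanSpace ℂ s)}

/-- For a unit code vector `y`, the isometry `V : w ↦ y ⊗ w` compresses `P_C ⊗ M` to `M`. -/
theorem norm_le_norm_codeProj_kronecker (hC : C ≠ ⊥) (M : Matrix b b ℂ) :
    ‖M‖ ≤ ‖codeProj C ⊗ₖ M‖ := by
  obtain ⟨x, hxC, hx0⟩ := C.ne_bot_iff.1 hC
  obtain ⟨y, hyC, hy1⟩ : ∃ y ∈ C, ‖y‖ = 1 :=
    ⟨(‖x‖ : ℂ)⁻¹ • x, C.smul_mem _ hxC, norm_smul_inv_norm hx0⟩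
  let V : Matrix (s × b) b ℂ := Matrix.of fun p l => y.ofLp p.1 * (1 : Matrix b b ℂ) p.2 l
  have hV : ∀ (A : Matrix s s ℂ) (D : Matrix b b ℂ),
      Vᴴ * (A ⊗ₖ D) * V = (star y.ofLp ⬝ᵥ A *ᵥ y.ofLp) • D := fun A D => by
    ext k l
    simp [V, Matrix.mul_apply, Fintype.sum_prod_type, Matrix.one_apply, dotProduct,
      Matrix.mulVec, Finset.sum_mul, Finset.mul_sum,
      apply_ite (starRingEnd ℂ)]
    rw [Finset.sum_comm]
    exact Finset.sum_congr rfl fun i _ => Finset.sum_congr rfl fun i' _ => by ring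
  have hyy : star y.ofLp ⬝ᵥ y.ofLp = 1 := by
    rw [dotProduct_comm, ← EuclideanSpace.inner_eq_star_dotProduct, inner_self_eq_norm_sq_to_K,
      hy1]
    simp
  have hVV : Vᴴ * V = 1 := by
    have := hV 1 1
    rwa [Matrix.one_kronecker_one, Matrix.mul_one, Matrix.one_mulVec, hyy, one_smul] at this
  have hM : Vᴴ * (codeProj C ⊗ₖ M) * V = M := by
    rw [hV, codeProj_mulVec hyC, hyy, one_smul]
  have hV1 : ‖V‖ ≤ 1 := by
    have h1 : ‖V‖ * ‖V‖ ≤ 1 := by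
      rw [← Matrix.l2_opNorm_conjTranspose_mul_self, hVV, ← Matrix.diagonal_one,
        Matrix.l2_opNorm_diagonal]
      exact (pi_norm_le_iff_of_nonneg zero_le_one).2 fun _ => by simp
    nlinarith [norm_nonneg V]
  calc ‖M‖ = ‖Vᴴ * (codeProj C ⊗ₖ M) * V‖ := by rw [hM]
    _ ≤ ‖Vᴴ * (codeProj C ⊗ₖ M)‖ * ‖V‖ := Matrix.l2_opNorm_mul _ _
    _ ≤ (‖Vᴴ‖ * ‖codeProj C ⊗ₖ M‖) * ‖V‖ := by gcongr; exact Matrix.l2_opNorm_mul _ _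
    _ ≤ (1 * ‖codeProj C ⊗ₖ M‖) * 1 := by
        rw [Matrix.l2_opNorm_conjTranspose]
        gcongr
    _ = ‖codeProj C ⊗ₖ M‖ := by ring

end Compression

end OSQEC
namespace OSQEC

/-! ### Second-order expansion of the overlap. -/

section Estimates

variable {n : Type*} [Fintype n] [DecidableEq n]

/-- The polynomial `1 + h/2 + 9h²/25`, a slightly shrunk approximation of `(1 - h)^(-1/2)`. -/
noncomputable def invSqrtApprox (h : Matrix n n ℂ) : Matrix n n ℂ :=
  1 + (1 / 2 : ℂ) • h + (9 / 25 : ℂ) • (h * h)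

theorem invSqrtApprox_isHermitian {h : Matrix n n ℂ} (hh : h.IsHermitian) :
    (invSqrtApprox h)ᴴ = invSqrtApprox h := by
  simp [invSqrtApprox, hh.eq]

theorem one_sub_invSqrtApprox_posSemidef {h : Matrix n n ℂ} (hh : h.IsHermitian)
    (hn : ‖h‖ ≤ 1 / 25) :
    (1 - invSqrtApprox h * (1 - h) * invSqrtApprox h).PosSemidef := by
  -- `1 - p(1 - h)p = h(3/100 - K)h`. The slack `3/100 = 3/4 - 2·(9/25)` comes from taking `9/25`
  -- below the Taylor coefficient `3/8`; it dominates `K` once `‖h‖ ≤ 1/25`.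
  set K := -((61 / 100 : ℂ) • h + (144 / 625 : ℂ) • (h * h) + (81 / 625 : ℂ) • (h * h * h)) with hK
  have hKh : K.IsHermitian := by
    rw [Matrix.IsHermitian, hK]
    simp [hh.eq, Matrix.mul_assoc]
  have h2 : ‖h * h‖ ≤ 1 / 25 * (1 / 25) :=
    (norm_mul_le h h).trans (mul_le_mul hn hn (norm_nonneg _) (by norm_num))
  have h3 : ‖h * h * h‖ ≤ 1 / 25 * (1 / 25) * (1 / 25) :=
    (norm_mul_le (h * h) h).trans (mul_le_mul h2 hn (norm_nonneg _) (by norm_num))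
  have hKn : ‖K‖ ≤ 3 / 100 := by
    rw [hK, norm_neg]
    refine (norm_add₃_le).trans ?_
    rw [norm_smul, norm_smul, norm_smul]
    norm_num
    linarith
  have key := (posSemidef_smul_one_sub hKh hKn).mul_mul_conjTranspose_same h
  convert key using 1
  rw [hh.eq, hK, invSqrtApprox]
  push_cast
  simp only [Matrix.mul_add, Matrix.add_mul, Matrix.mul_sub, Matrix.sub_mul, Matrix.smul_mul,
    Matrix.mul_smul, Matrix.mul_assoc, Matrix.mul_one, Matrix.one_mul, sub_neg_eq_add]
  module

omit [DecidableEq n] in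
-- The coefficient `11/100` is `9/25 - 1/4`. The final bracket collects the terms that become cubic,
-- since `H` and `T` are of first order and `D` of second.
theorem overlap_expansion {P H D T : Matrix n n ℂ} (hHP : H * P = H) (hPP : P * P = P)
    (hPH : P * H = H) (hPD : P * D = D) (hPT : P * T = T) :
    (P + (1 / 2 : ℂ) • H + (9 / 25 : ℂ) • (H * H)) * (P - (1 / 2 : ℂ) • (H + D + T))
      = P - (1 / 2 : ℂ) • D - (1 / 2 : ℂ) • T + (11 / 100 : ℂ) • (H * H) - (1 / 4 : ℂ) • (H * T)
        - ((1 / 4 : ℂ) • (H * D) + (9 / 50 : ℂ) • (H * H * (H + D + T))) := by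
  simp only [Matrix.mul_add, Matrix.add_mul, Matrix.mul_sub, Matrix.smul_mul,
    Matrix.mul_smul, Matrix.mul_assoc, hHP, hPP, hPH, hPD, hPT, smul_add]
  module

theorem re_trace_mul_overlap_ge {ρ P H D T Q : Matrix n n ℂ} (hρ : IsState ρ)
    (hP : ρ * P = ρ) (hH : Hᴴ = H) (hT : Tᴴ = -T) :
    1 - (1 / 2 * ‖D‖ + 25 / 176 * ‖Tᴴ * T‖ + ‖Q‖) ≤
      (ρ * (P - (1 / 2 : ℂ) • D - (1 / 2 : ℂ) • T + (11 / 100 : ℂ) • (H * H)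
        - (1 / 4 : ℂ) • (H * T) - Q)).trace.re := by
  have hρh : ρᴴ = ρ := hρ.1.1
  have hb : ∀ M : Matrix n n ℂ, |(ρ * M).trace.re| ≤ ‖M‖ := fun M => by
    have := abs_re_trace_mul_le (K := M) hρ.1
    rwa [hρ.2, Complex.one_re, mul_one, Matrix.trace_mul_comm] at this
  have hTre : (ρ * T).trace.re = 0 := by
    have := re_trace_conjTranspose (ρ * T)
    rw [Matrix.conjTranspose_mul, hT, hρh, Matrix.neg_mul, Matrix.trace_neg,
      Matrix.trace_mul_comm, Complex.neg_re] at this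
    linarith
  have hTH : (ρ * (T * H)).trace.re = -(ρ * (H * T)).trace.re := by
    rw [← re_trace_conjTranspose, Matrix.conjTranspose_mul, Matrix.conjTranspose_mul, hT, hH,
      hρh, Matrix.mul_neg, Matrix.neg_mul, Matrix.trace_neg, Matrix.trace_mul_comm,
      Complex.neg_re]
  -- Completing the square: `(11/100)(25/22) = 1/8`, which the `HT` and `TH` terms double to the
  -- required `1/4`, and the remainder is `(11/100)(25/22)² = 25/176`.
  have hsq := trace_mul_nonneg hρ.1
    (Matrix.posSemidef_conjTranspose_mul_self (H - (25 / 22 : ℂ) • T))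
  have hexp : (H - (25 / 22 : ℂ) • T)ᴴ * (H - (25 / 22 : ℂ) • T)
      = H * H - ((25 / 22 : ℝ) : ℂ) • (H * T) + ((25 / 22 : ℝ) : ℂ) • (T * H)
        + ((625 / 484 : ℝ) : ℂ) • (Tᴴ * T) := by
    simp only [Matrix.conjTranspose_sub, Matrix.conjTranspose_smul, hT, hH, Matrix.mul_sub,
      Matrix.sub_mul, Matrix.smul_mul, Matrix.mul_smul, Matrix.neg_mul, smul_neg]
    have : star (25 / 22 : ℂ) = 25 / 22 := by simp
    rw [this]
    push_cast
    module
  rw [hexp] at hsq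
  have e : ∀ r : ℝ, ∀ M : Matrix n n ℂ, (ρ * ((r : ℂ) • M)).trace.re = r * (ρ * M).trace.re :=
    fun r M => by simp
  have e1 : (1 / 2 : ℂ) = ((1 / 2 : ℝ) : ℂ) := by norm_num
  have e2 : (11 / 100 : ℂ) = ((11 / 100 : ℝ) : ℂ) := by norm_num
  have e3 : (1 / 4 : ℂ) = ((1 / 4 : ℝ) : ℂ) := by norm_num
  rw [e1, e2, e3]
  simp only [Matrix.mul_add, Matrix.mul_sub, Matrix.trace_add, Matrix.trace_sub, Complex.add_re,
    Complex.sub_re, e, hTre, hTH, hP, hρ.2, Complex.one_re] at hsq ⊢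
  have h1 := (abs_le.1 (hb D)).2
  have h2 := (abs_le.1 (hb Q)).2
  have h3 := (abs_le.1 (hb (Tᴴ * T))).2
  linarith

end Estimates

/-! ### Fidelity loss under perturbed noise and the final bound. -/

section Noise

variable {s b ι κ : Type*} [Fintype s] [DecidableEq s] [Fintype b] [DecidableEq b]
  [Fintype ι] [Fintype κ]

section

variable (b) (C : Submodule ℂ (EuclideanSpace ℂ s))

theorem jointProj_mul_self : jointProj b C * jointProj b C = jointProj b C := by
  rw [jointProj, ← Matrix.mul_kronecker_mul, codeProj_mul_self, Matrix.one_mul]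

omit [Fintype b] in
theorem jointProj_conjTranspose : (jointProj b C)ᴴ = jointProj b C := by
  rw [jointProj, Matrix.conjTranspose_kronecker, codeProj_conjTranspose, Matrix.conjTranspose_one]

theorem norm_jointProj_le : ‖jointProj b C‖ ≤ 1 := by
  have h := Matrix.l2_opNorm_conjTranspose_mul_self (jointProj b C)
  rw [jointProj_conjTranspose, jointProj_mul_self] at h
  nlinarith [norm_nonneg (jointProj b C)]

end

/-- `∑ R†R = 1` cancels in the middle, so Gram sums may be computed before or after the recovery. -/
theorem sum_recovery_mul {R : κ → Matrix s s ℂ} (hR : IsTracePreserving R)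
    (A D : ι → Matrix (s × b) (s × b) ℂ) :
    ∑ p : κ × ι, ((R p.1 ⊗ₖ (1 : Matrix b b ℂ)) * A p.2)ᴴ * ((R p.1 ⊗ₖ (1 : Matrix b b ℂ)) * D p.2)
      = ∑ a, (A a)ᴴ * D a := by
  rw [Fintype.sum_prod_type_right]
  refine Finset.sum_congr rfl fun a _ => ?_
  have h : ∀ c, ((R c ⊗ₖ (1 : Matrix b b ℂ)) * A a)ᴴ * ((R c ⊗ₖ (1 : Matrix b b ℂ)) * D a)
      = (A a)ᴴ * ((R c ⊗ₖ (1 : Matrix b b ℂ))ᴴ * (R c ⊗ₖ (1 : Matrix b b ℂ))) * D a := fun c => by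
    rw [Matrix.conjTranspose_mul]
    simp only [Matrix.mul_assoc]
  simp only [h]
  rw [← Finset.sum_mul, ← Finset.mul_sum, isTracePreserving_kronecker hR, Matrix.mul_one]

theorem opNorm_eq_norm {n : Type*} [Fintype n] [DecidableEq n] (M : Matrix n n ℂ) :
    opNorm M = ‖M‖ :=
  rfl

theorem norm_Delta (C : Submodule ℂ (EuclideanSpace ℂ s)) (B : ι → Matrix (s × b) (s × b) ℂ) :
    ‖Delta C B‖ = sizeBP C B ^ 2 := by
  rw [sizeBP, opNorm_eq_norm, Real.sq_sqrt (norm_nonneg _), Delta]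
  congr 1
  refine Finset.sum_congr rfl fun a _ => ?_
  rw [Matrix.conjTranspose_mul, jointProj_conjTranspose]
  simp only [Matrix.mul_assoc]

theorem one_sub_sq_le {F x : ℝ} (h : 1 - x ≤ F) : 1 - F ^ 2 ≤ 2 * x := by
  nlinarith [sq_nonneg (1 - F)]

/-- Fidelity loss of a recovery that is perfect for the truncated noise `Et`. -/
theorem fidelityLoss_le {C : Submodule ℂ (EuclideanSpace ℂ s)} (hC : C ≠ ⊥)
    {R : κ → Matrix s s ℂ} {E Et B : ι → Matrix (s × b) (s × b) ℂ} {X : κ → ι → Matrix b b ℂ}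
    (hR : IsTracePreserving R) (hE : IsTracePreserving E) (hEB : ∀ a, E a = Et a + B a)
    (hX : ∀ c a, (R c ⊗ₖ (1 : Matrix b b ℂ)) * Et a * jointProj b C = codeProj C ⊗ₖ X c a)
    (hβ : sizeBP C B ≤ 1 / 75) {ρ : Matrix (s × b) (s × b) ℂ} (hρ : IsCodeState C ρ) :
    fidelityLoss R E ρ ≤ 25 / 88 * ‖(Theta C Et B)ᴴ * Theta C Et B‖ + ‖Delta C B‖
      + 22 * sizeBP C B ^ 3 := by
  classical
  set P := jointProj b C with hPdef
  set β := sizeBP C B with hβdef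
  have hβ0 : 0 ≤ β := Real.sqrt_nonneg _
  have hPP : P * P = P := jointProj_mul_self b C
  have hPh : Pᴴ = P := jointProj_conjTranspose b C
  set D := Delta C B with hDdef
  set T := Theta C Et B with hTdef
  have hDn : ‖D‖ = β ^ 2 := norm_Delta C B
  have hDsum : D = ∑ a, (B a * P)ᴴ * (B a * P) := by
    refine Finset.sum_congr rfl fun a _ => ?_
    rw [Matrix.conjTranspose_mul, hPh]
    simp only [Matrix.mul_assoc]
    rfl
  have hDh : Dᴴ = D := by
    rw [hDsum, Matrix.conjTranspose_sum]
    simp only [Matrix.conjTranspose_mul, Matrix.conjTranspose_conjTranspose, Matrix.mul_assoc]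
  set Y := ∑ a, (Et a * P)ᴴ * (B a * P) with hYdef
  have hYh : Yᴴ = ∑ a, (B a * P)ᴴ * (Et a * P) := by
    rw [hYdef, Matrix.conjTranspose_sum]
    simp only [Matrix.conjTranspose_mul, Matrix.conjTranspose_conjTranspose]
  set Gr := ∑ a, (Et a * P)ᴴ * (Et a * P) with hGrdef
  have hTY : T = Yᴴ - Y := by
    rw [hYh, hYdef, ← Finset.sum_sub_distrib]
    refine Finset.sum_congr rfl fun a _ => ?_
    simp only [Matrix.conjTranspose_mul, hPh, Matrix.mul_sub, Matrix.sub_mul, Matrix.mul_assoc]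
    rfl
  have hEE : ∑ a, (E a * P)ᴴ * (E a * P) = P := by
    have : ∀ a, (E a * P)ᴴ * (E a * P) = P * ((E a)ᴴ * E a) * P := fun a => by
      rw [Matrix.conjTranspose_mul, hPh]
      simp only [Matrix.mul_assoc]
    simp only [this]
    rw [← Finset.sum_mul, ← Finset.mul_sum, hE, Matrix.mul_one, hPP]
  have hEP : ∀ a, E a * P = Et a * P + B a * P := fun a => by rw [hEB, Matrix.add_mul]
  have hEtE : ∑ a, (Et a * P)ᴴ * (E a * P) = Gr + Y := by
    simp only [hEP, Matrix.mul_add, Finset.sum_add_distrib, hGrdef, hYdef]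
  have hEB' : ∑ a, (E a * P)ᴴ * (B a * P) = Y + D := by
    simp only [hEP, Matrix.conjTranspose_add, Matrix.add_mul, Finset.sum_add_distrib, hDsum, hYdef]
  have hTP : Gr + Y + Yᴴ + D = P := by
    rw [← hEE]
    simp only [hEP, Matrix.conjTranspose_add, Matrix.mul_add, Matrix.add_mul,
      Finset.sum_add_distrib]
    rw [← hYh, ← hYdef, ← hGrdef, ← hDsum]
    abel
  set G := ∑ p : κ × ι, (X p.1 p.2)ᴴ * X p.1 p.2 with hGdef
  have hX' : ∀ c a, (R c ⊗ₖ (1 : Matrix b b ℂ)) * (Et a * P) = codeProj C ⊗ₖ X c a := fun c a => by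
    rw [← Matrix.mul_assoc, hX]
  have hGr : Gr = codeProj C ⊗ₖ G := by
    rw [hGrdef, ← sum_recovery_mul hR]
    simp only [hX', Matrix.conjTranspose_kronecker, ← Matrix.mul_kronecker_mul,
      codeProj_conjTranspose, codeProj_mul_self]
    ext ⟨i, k⟩ ⟨i', l⟩
    simp [hGdef, Matrix.sum_apply, Finset.mul_sum]
  set h := 1 - G with hhdef
  set H := P - Gr with hHdef
  have hHk : H = codeProj C ⊗ₖ h := by
    rw [hHdef, hGr, hPdef, jointProj, hhdef]
    ext ⟨i, k⟩ ⟨i', l⟩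
    simp [mul_sub]
  have hPH : P * H = H := by
    rw [hHk, hPdef, jointProj, ← Matrix.mul_kronecker_mul, codeProj_mul_self, Matrix.one_mul]
  have hGh : Gᴴ = G := by
    rw [hGdef, Matrix.conjTranspose_sum]
    simp only [Matrix.conjTranspose_mul, Matrix.conjTranspose_conjTranspose]
  have hhh : h.IsHermitian := by
    rw [Matrix.IsHermitian, hhdef, Matrix.conjTranspose_sub, hGh, Matrix.conjTranspose_one]
  have hHh : Hᴴ = H := by
    rw [hHk, Matrix.conjTranspose_kronecker, codeProj_conjTranspose, hhh.eq]
  have hHP : H * P = H := by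
    rw [← hHh, ← hPh, ← Matrix.conjTranspose_mul, hPH]
  have hPD : P * D = D := by
    rw [hDsum, Finset.mul_sum]
    simp only [Matrix.conjTranspose_mul, hPh, ← Matrix.mul_assoc, hPP]
  have hPT : P * T = T := by
    rw [hTY, hYh, hYdef, Matrix.mul_sub, Finset.mul_sum, Finset.mul_sum]
    simp only [Matrix.conjTranspose_mul, hPh, ← Matrix.mul_assoc, hPP]
  have hTh : Tᴴ = -T := by
    rw [hTY, Matrix.conjTranspose_sub, Matrix.conjTranspose_conjTranspose, neg_sub]
  -- `Y + D` pairs `B` with the full noise `E`, whose Gram sum on the code is `P`; Cauchy-Schwarz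
  -- then needs no bound on `Et`.
  have hZn : ‖Y + D‖ ≤ β := by
    rw [← hEB']
    refine (norm_sum_conjTranspose_mul_le _ _).trans ?_
    rw [hEE, ← hDsum, hDn, Real.sqrt_sq hβ0]
    exact mul_le_of_le_one_left hβ0 (Real.sqrt_le_one.2 (norm_jointProj_le b C))
  have hZn' : ‖Yᴴ + D‖ ≤ β := by
    rwa [← hDh, ← Matrix.conjTranspose_add, Matrix.l2_opNorm_conjTranspose]
  have hTn : ‖T‖ ≤ 2 * β := by
    have : T = (Yᴴ + D) - (Y + D) := by rw [hTY]; abel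
    rw [this]
    exact (norm_sub_le _ _).trans (by linarith)
  -- The norm is at most `2β + β²`, and `β ≤ 1`.
  have hHn : ‖H‖ ≤ 3 * β := by
    have : H = (Yᴴ + D) + (Y + D) - D := by rw [hHdef, ← hTP]; abel
    rw [this]
    refine (norm_sub_le _ _).trans ?_
    have := norm_add_le (Yᴴ + D) (Y + D)
    nlinarith
  have hhn : ‖h‖ ≤ 1 / 25 := by
    have := norm_le_norm_codeProj_kronecker hC h
    rw [← hHk] at this
    linarith
  set p := invSqrtApprox h with hpdef
  have hph : pᴴ = p := invSqrtApprox_isHermitian hhh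
  -- The `X c a` are nearly normalized by `p ≈ G^(-1/2)`, giving bath-only operators for the
  -- comparison purification.
  let W : κ × ι → Matrix b b ℂ := fun c => X c.1 c.2 * p
  have hW : (1 - ∑ c, (W c)ᴴ * W c).PosSemidef := by
    have : ∑ c, (W c)ᴴ * W c = p * (1 - h) * p := by
      rw [hhdef, sub_sub_cancel, hGdef, Finset.mul_sum, Finset.sum_mul]
      refine Finset.sum_congr rfl fun c _ => ?_
      simp only [W, Matrix.conjTranspose_mul, hph, Matrix.mul_assoc]
    rw [this]
    exact one_sub_invSqrtApprox_posSemidef hhh hhn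
  have hpP : ((1 : Matrix s s ℂ) ⊗ₖ p) * P = P + (1 / 2 : ℂ) • H + (9 / 25 : ℂ) • (H * H) := by
    rw [hHk, hPdef, jointProj, ← Matrix.mul_kronecker_mul, ← Matrix.mul_kronecker_mul,
      codeProj_mul_self, Matrix.one_mul, Matrix.mul_one, hpdef, invSqrtApprox,
      Matrix.kronecker_add, Matrix.kronecker_add, Matrix.kronecker_smul, Matrix.kronecker_smul]
  have hN : Gr + Y = P - (1 / 2 : ℂ) • (H + D + T) := by
    rw [hHdef, hTY, ← hTP]
    module
  set L := CFC.sqrt ρ with hLdef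
  have hρL : ρ = L * Lᴴ := by
    rw [hLdef, (sqrt_posSemidef ρ).1.eq, sqrt_mul_sqrt hρ.1.1]
  have hρP : ρ * P = ρ := by
    conv_lhs => rw [← hρ.2, Matrix.mul_assoc, hPP]
    exact hρ.2
  have hPρ : P * ρ = ρ := by
    conv_lhs => rw [← hρ.2, ← Matrix.mul_assoc, ← Matrix.mul_assoc, hPP]
    exact hρ.2
  have hM : ((purify fun c : κ × ι => ((1 : Matrix s s ℂ) ⊗ₖ W c) * L)ᴴ
      * purify fun c : κ × ι => ((R c.1 ⊗ₖ (1 : Matrix b b ℂ)) * E c.2) * L).trace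
      = (ρ * (((1 : Matrix s s ℂ) ⊗ₖ p) * (Gr + Y))).trace := by
    rw [trace_purify_conjTranspose_mul, ← hEtE, ← sum_recovery_mul hR, Finset.mul_sum,
      Finset.mul_sum, Matrix.trace_sum]
    refine Finset.sum_congr rfl fun c _ => ?_
    -- Both sides equal `P_C ⊗ p X†`; this is where perfect correctability moves the factor `p`
    -- through the recovered noise.
    have h1 : ((1 : Matrix s s ℂ) ⊗ₖ p) * ((R c.1 ⊗ₖ (1 : Matrix b b ℂ)) * (Et c.2 * P))ᴴ
        = P * ((1 : Matrix s s ℂ) ⊗ₖ W c)ᴴ := by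
      rw [hX', ← hPh, ← Matrix.conjTranspose_mul, hPdef, jointProj,
        ← Matrix.mul_kronecker_mul, Matrix.conjTranspose_kronecker, Matrix.conjTranspose_kronecker,
        ← Matrix.mul_kronecker_mul]
      simp only [W, Matrix.one_mul, Matrix.mul_one, Matrix.conjTranspose_mul, hph]
    have h2 : ρ * (((1 : Matrix s s ℂ) ⊗ₖ p) * (((R c.1 ⊗ₖ (1 : Matrix b b ℂ)) * (Et c.2 * P))ᴴ
        * ((R c.1 ⊗ₖ (1 : Matrix b b ℂ)) * (E c.2 * P))))
        = (ρ * P) * (((1 : Matrix s s ℂ) ⊗ₖ W c)ᴴ * ((R c.1 ⊗ₖ (1 : Matrix b b ℂ)) * E c.2)) * P := by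
      rw [← Matrix.mul_assoc ((1 : Matrix s s ℂ) ⊗ₖ p), h1]
      simp only [Matrix.mul_assoc]
    rw [h2, Matrix.trace_mul_comm _ P, hρP, ← Matrix.mul_assoc P, hPρ, Matrix.conjTranspose_mul]
    conv_rhs => rw [hρL, Matrix.mul_assoc, Matrix.trace_mul_comm]
    simp only [Matrix.mul_assoc]
  set Q := (1 / 4 : ℂ) • (H * D) + (9 / 50 : ℂ) • (H * H * (H + D + T)) with hQdef
  have hexp : ((1 : Matrix s s ℂ) ⊗ₖ p) * (Gr + Y) = P - (1 / 2 : ℂ) • D - (1 / 2 : ℂ) • T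
      + (11 / 100 : ℂ) • (H * H) - (1 / 4 : ℂ) • (H * T) - Q := by
    rw [← overlap_expansion hHP hPP hPH hPD hPT, ← hpP, hN, Matrix.mul_assoc]
    congr 1
    simp only [Matrix.mul_sub, Matrix.mul_smul, Matrix.mul_add, hPP, hPH, hPD, hPT]
  -- The terms add up to `3/4 + (9/50)·54 = 10.47`, rounded up to `11`.
  have hQn : ‖Q‖ ≤ 11 * β ^ 3 := by
    have h1 : ‖H * D‖ ≤ 3 * β * β ^ 2 := (norm_mul_le _ _).trans (by rw [hDn]; gcongr)
    have h2 : ‖H + D + T‖ ≤ 6 * β := (norm_add₃_le).trans (by rw [hDn]; nlinarith)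
    have h3 : ‖H * H * (H + D + T)‖ ≤ 3 * β * (3 * β) * (6 * β) := by
      refine (norm_mul_le _ _).trans ?_
      gcongr
      exact (norm_mul_le _ _).trans (by gcongr)
    refine (norm_add_le _ _).trans ?_
    rw [norm_smul, norm_smul]
    norm_num
    nlinarith [pow_nonneg hβ0 3]
  have hF := re_trace_le_fidelity (σ := recovered R E ρ) (traceBath_posSemidef hρ.1.1) _ _
    (by rw [hρL]; exact traceBath_sub_purify_posSemidef hW L)
    (by rw [hρL]; exact recovered_eq_purify R E L)
  rw [hM, hexp] at hF
  have hfin := one_sub_sq_le ((re_trace_mul_overlap_ge hρ.1 hρP hHh hTh).trans hF)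
  rw [fidelityLoss]
  linarith

theorem fidelityLoss_nonneg {R : κ → Matrix s s ℂ} {E : ι → Matrix (s × b) (s × b) ℂ}
    (hR : IsTracePreserving R) (hE : IsTracePreserving E) {ρ : Matrix (s × b) (s × b) ℂ}
    (hρ : IsState ρ) : 0 ≤ fidelityLoss R E ρ := by
  rw [fidelityLoss, sub_nonneg]
  exact pow_le_one₀ (fidelity_nonneg _ _)
    (fidelity_le_one (traceBath_isState hρ) (recovered_isState hR hE hρ))

theorem worstLoss_nonneg {C : Submodule ℂ (EuclideanSpace ℂ s)} {R : κ → Matrix s s ℂ}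
    {E : ι → Matrix (s × b) (s × b) ℂ} (hR : IsTracePreserving R) (hE : IsTracePreserving E) :
    0 ≤ worstLoss C R E := by
  refine Real.sSup_nonneg ?_
  rintro _ ⟨ρ, hρ, rfl⟩
  exact fidelityLoss_nonneg hR hE hρ.1

/-- Nonnegativity of the losses bounds the set below, without which the real infimum would not be a
lower bound. -/
theorem optLoss_le_worstLoss {C : Submodule ℂ (EuclideanSpace ℂ s)} {m : ℕ}
    {R : Fin m → Matrix s s ℂ} {E : ι → Matrix (s × b) (s × b) ℂ} (hR : IsRecovery C R)
    (hE : IsTracePreserving E) : optLoss C E ≤ worstLoss C R E := by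
  refine csInf_le ⟨0, ?_⟩ ⟨m, R, hR, rfl⟩
  rintro _ ⟨_, R', hR', rfl⟩
  exact worstLoss_nonneg hR'.1 hE

/-- The approximate correctability bound with the explicit constant `75³`. -/
theorem isEpsCorrectable_of_perturbation {C : Submodule ℂ (EuclideanSpace ℂ s)} (hC : C ≠ ⊥)
    {E Et B : ι → Matrix (s × b) (s × b) ℂ} (hE : IsTracePreserving E)
    (hEB : ∀ a, E a = Et a + B a) (hEt : IsPerfectlyCorrectable C Et) :
    IsEpsCorrectable C E
      ((1 + √2) / 8 * opNorm ((Theta C Et B)ᴴ * Theta C Et B) + opNorm (Delta C B)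
        + 75 ^ 3 * sizeBP C B ^ 3) := by
  obtain ⟨m, R, hR, hperf⟩ := hEt
  obtain ⟨X, hX⟩ := exists_recovered_kraus_eq hperf
  have hΘ : 0 ≤ opNorm ((Theta C Et B)ᴴ * Theta C Et B) := norm_nonneg _
  have hΔ : 0 ≤ opNorm (Delta C B) := norm_nonneg _
  have hβ : 0 ≤ sizeBP C B := Real.sqrt_nonneg _
  have hsqrt : (7 / 5 : ℝ) ≤ √2 := Real.le_sqrt_of_sq_le (by norm_num)
  -- Nonnegativity of the bound is required because the real supremum of an empty set is `0`.
  refine (optLoss_le_worstLoss hR hE).trans (Real.sSup_le ?_ (by positivity))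
  rintro _ ⟨ρ, hρ, rfl⟩
  -- The threshold `1/75` ensures `‖h‖ ≤ 3β ≤ 1/25`; beyond it `75³ β³ ≥ 1` already exceeds any
  -- loss.
  rcases le_total (sizeBP C B) (1 / 75) with hsmall | hlarge
  · have h := fidelityLoss_le hC hR.1 hE hEB hX hsmall hρ
    change _ ≤ 25 / 88 * opNorm ((Theta C Et B)ᴴ * Theta C Et B) + opNorm (Delta C B) + _ at h
    nlinarith [pow_nonneg hβ 3]
  · have h1 : (1 : ℝ) ≤ 75 ^ 3 * sizeBP C B ^ 3 := by
      rw [← mul_pow]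
      exact one_le_pow₀ (by linarith)
    have h2 : fidelityLoss R E ρ ≤ 1 := sub_le_self _ (sq_nonneg _)
    have h3 : 0 ≤ (1 + √2) / 8 * opNorm ((Theta C Et B)ᴴ * Theta C Et B) := by positivity
    linarith

end Noise

end OSQEC

theorem theorem2 :
    ∃ K : ℝ, ∀ (dS dB N : ℕ) (C : Submodule ℂ (EuclideanSpace ℂ (Fin dS)))
      (E Et B : Fin N → Matrix (Fin dS × Fin dB) (Fin dS × Fin dB) ℂ),
      0 < dB → C ≠ ⊥ →
      OSQEC.IsTracePreserving E →
      (∀ a, E a = Et a + B a) →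
      OSQEC.IsPerfectlyCorrectable C Et →
      OSQEC.IsEpsCorrectable C E
        ((1 + √2) / 8 * OSQEC.opNorm ((OSQEC.Theta C Et B)ᴴ * OSQEC.Theta C Et B)
          + OSQEC.opNorm (OSQEC.Delta C B) + K * OSQEC.sizeBP C B ^ 3) :=
  ⟨75 ^ 3, fun _ _ _ _ _ _ _ _ hC hE hEB hEt =>
    OSQEC.isEpsCorrectable_of_perturbation hC hE hEB hEt⟩
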